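/- Let $\mathbb{F}\in\{\mathbb{R},\mathbb{C}\}$, let $n,k\ge 1$ be integers, let $T_j$ be the $j$-th Chebyshev polynomial of the first kind, and let $P(z)=\sum_{j=0}^{k}P_jT_j(z)$, $P_j\in\mathbb{F}^{n\times n}$, be a matrix polynomial (of grade $k$), not identically zero. Put $\Lambda(z)=[T_{k-1}(z),\dots,T_0(z)]^T$. Let $L(z)=zX+Y$, with $X,Y\in\mathbb{F}^{nk\times nk}$, be the pencil in the double ansatz space $\mathbb{DL}(P)$ with ansatz polynomial $v(z)=\sum_{j=0}^{k-1}v_jT_j(z)=1$. That is, with the ansatz vector $v=[v_{k-1},\dots,v_0]^T$, $$L(z)\,(\Lambda(z)\otimes I_n)=v\otimes P(z)\qquad\text{and}\qquad (\Lambda(z)^T\otimes I_n)\,L(z)=w^T\otimes P(z)$$ for all $z$ and some $w\in\mathbb{F}^k$. For a matrix polynomial $A$ write $\|A(\cdot)\|=\max_{t\in[-1,1]}\|A(t)\|_2$. Let $\lambda\in[-1,1]$ be an eigenvalue of $P$ with right and left eigenvectors $x,y\in\mathbb{F}^n\setminus\{0\}$, that is, $P(\lambda)x=0$ and $y^TP(\lambda)=0$,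 and put $\widehat x=\Lambda(\lambda)\otimes x$, $\widehat y=\Lambda(\lambda)\otimes y$. Then the conditioning ratio $$\widehat r_\lambda=\frac{1}{|v(\lambda)|}\,\frac{\|\widehat y\|_2\,\|L(\cdot)\|\,\|\widehat x\|_2}{\|y\|_2\,\|P(\cdot)\|\,\|x\|_2}$$ satisfies $$\widehat r_\lambda\le 16\,n\,(e-1)\,k^4 .$$ -/

import Mathlib

noncomputable section

namespace ChebDL

variable {𝕜 : Type*} [RCLike 𝕜] {n k : ℕ}

/-- Value at `z` of the matrix polynomial `P = ∑ⱼ Pⱼ Tⱼ` of grade `k`, where `Tⱼ` is the `j`-th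
Chebyshev polynomial of the first kind. -/
def matPolyEval (P : Fin (k + 1) → Matrix (Fin n) (Fin n) 𝕜) (z : 𝕜) :
    Matrix (Fin n) (Fin n) 𝕜 :=
  ∑ j : Fin (k + 1), (Polynomial.Chebyshev.T 𝕜 ((j : ℕ) : ℤ)).eval z • P j

/-- The vector `Λ(z) = [T_{k-1}(z), …, T_0(z)]ᵀ`. -/
def chebVec (k : ℕ) (z : 𝕜) : Fin k → 𝕜 :=
  fun i => (Polynomial.Chebyshev.T 𝕜 ((i.rev : ℕ) : ℤ)).eval z

/-- Value at `z` of the ansatz polynomial `v(z) = ∑ⱼ vⱼ Tⱼ(z)` with ansatz vector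
`v = [v_{k-1}, …, v_0]ᵀ`. -/
def ansatzEval (v : Fin k → 𝕜) (z : 𝕜) : 𝕜 :=
  ∑ i : Fin k, v i * chebVec k z i

/-- The Kronecker product `v ⊗ A` of a column vector and an `n × n` matrix. -/
def colKron (v : Fin k → 𝕜) (A : Matrix (Fin n) (Fin n) 𝕜) :
    Matrix (Fin k × Fin n) (Fin n) 𝕜 :=
  Matrix.of fun p b => v p.1 * A p.2 b

/-- The Kronecker product `vᵀ ⊗ A` of a row vector and an `n × n` matrix. -/
def rowKron (v : Fin k → 𝕜) (A : Matrix (Fin n) (Fin n) 𝕜) :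
    Matrix (Fin n) (Fin k × Fin n) 𝕜 :=
  Matrix.of fun a q => v q.1 * A a q.2

/-- The Kronecker product `v ⊗ w` of two vectors. -/
def vecKron (v : Fin k → 𝕜) (w : Fin n → 𝕜) : Fin k × Fin n → 𝕜 :=
  fun p => v p.1 * w p.2

/-- The pencil `L(z) = z X + Y`, whose coefficients are block matrices with `k × k` blocks of size
`n × n`; the first index of a pair is the block index, the second one the index inside the block. -/
def pencil (X Y : Matrix (Fin k × Fin n) (Fin k × Fin n) 𝕜) (z : 𝕜) :
    Matrix (Fin k × Fin n) (Fin k × Fin n) 𝕜 :=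
  z • X + Y

/-- `L(z) = z X + Y` belongs to `𝕃₁(P)` with ansatz vector `v`:
`L(z) (Λ(z) ⊗ Iₙ) = v ⊗ P(z)`. -/
def MemL1 (P : Fin (k + 1) → Matrix (Fin n) (Fin n) 𝕜) (v : Fin k → 𝕜)
    (X Y : Matrix (Fin k × Fin n) (Fin k × Fin n) 𝕜) : Prop :=
  ∀ z : 𝕜, pencil X Y z * colKron (chebVec k z) (1 : Matrix (Fin n) (Fin n) 𝕜) =
    colKron v (matPolyEval P z)

/-- `L(z) = z X + Y` belongs to `𝕃₂(P)` with ansatz vector `w`: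
`(Λ(z)ᵀ ⊗ Iₙ) L(z) = wᵀ ⊗ P(z)`. -/
def MemL2 (P : Fin (k + 1) → Matrix (Fin n) (Fin n) 𝕜) (w : Fin k → 𝕜)
    (X Y : Matrix (Fin k × Fin n) (Fin k × Fin n) 𝕜) : Prop :=
  ∀ z : 𝕜, rowKron (chebVec k z) (1 : Matrix (Fin n) (Fin n) 𝕜) * pencil X Y z =
    rowKron w (matPolyEval P z)

/-- `L(z) = z X + Y` belongs to `𝔻𝕃(P) = 𝕃₁(P) ∩ 𝕃₂(P)` and has ansatz vector `v`. -/
def MemDL (P : Fin (k + 1) → Matrix (Fin n) (Fin n) 𝕜) (v : Fin k → 𝕜)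
    (X Y : Matrix (Fin k × Fin n) (Fin k × Fin n) 𝕜) : Prop :=
  MemL1 P v X Y ∧ ∃ w : Fin k → 𝕜, MemL2 P w X Y

/-- The spectral norm `‖A‖₂` of a square matrix, i.e. its operator norm for the Euclidean norm. -/
def matTwoNorm {m : Type*} [Fintype m] [DecidableEq m] (A : Matrix m m 𝕜) : ℝ :=
  ‖Matrix.toEuclideanCLM (n := m) (𝕜 := 𝕜) A‖

/-- The Euclidean norm of a vector. -/
def vecTwoNorm {m : Type*} [Fintype m] (u : m → 𝕜) : ℝ :=
  ‖WithLp.toLp 2 u‖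

/-- The norm `‖A(·)‖ = max_{t ∈ [-1,1]} ‖A(t)‖₂` of a (continuous) matrix function. -/
def supNorm {m : Type*} [Fintype m] [DecidableEq m] (A : 𝕜 → Matrix m m 𝕜) : ℝ :=
  ⨆ t : Set.Icc (-1 : ℝ) 1, matTwoNorm (A ((t : ℝ) : 𝕜))

/-- The conditioning ratio
`(1 / |v(lam)|) * (‖ŷ‖₂ ‖L(·)‖ ‖x̂‖₂) / (‖y‖₂ ‖P(·)‖ ‖x‖₂)`, with `x̂ = Λ(lam) ⊗ x`,
`ŷ = Λ(lam) ⊗ y`. -/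
def condRatio (P : Fin (k + 1) → Matrix (Fin n) (Fin n) 𝕜) (v : Fin k → 𝕜)
    (X Y : Matrix (Fin k × Fin n) (Fin k × Fin n) 𝕜) (lam : 𝕜) (x y : Fin n → 𝕜) : ℝ :=
  1 / ‖ansatzEval v lam‖ *
    ((vecTwoNorm (vecKron (chebVec k lam) y) * supNorm (pencil X Y) *
        vecTwoNorm (vecKron (chebVec k lam) x)) /
      (vecTwoNorm y * supNorm (matPolyEval P) * vecTwoNorm x))

end ChebDL

end

/-! Expand each entry of the pencil in products of Chebyshev polynomials, with coefficients `x a b`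
of `X` and `y a b` of `Y`. Both ansatz polynomials equal 1: the left one because both, multiplied by
the nonzero `P`, give the same polynomial. Comparing coefficients in the two ansatz identities and
eliminating `y` makes `x`, suitably normalised, a Hankel array `h (a + b)` with `h b - h (b + 2) = p
(b + 1)`, where `p` holds the coefficients of one entry of `P`. As `h` vanishes from `k` on,
telescoping bounds it by `k` times the largest `‖p b‖`.

Orthogonality gives `‖p b‖ ≤ 2 ‖P(·)‖`, so the pencil's entries are at most `18 k ‖P(·)‖` and its
norm at most `18 n k² ‖P(·)‖`. The two Kronecker vectors contribute `√k` each, and `18 n k³` is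
below the stated bound. The carrying lemmas are `norm_chebCoeff_le`, `hankel_of_shift`,
`norm_pencilCoeff_le` and `ansatzEval_eq_one_of_mem`. -/

noncomputable section

namespace ChebDL

/-! ### Chebyshev series: orthogonality and coefficient bounds -/

open Polynomial.Chebyshev in
theorem eval_T_ofReal {𝕜 : Type*} [RCLike 𝕜] (t : ℝ) (m : ℤ) :
    (T 𝕜 m).eval (t : 𝕜) = (((T ℝ m).eval t : ℝ) : 𝕜) := by
  exact (algebraMap_eval_T (R := ℝ) (R' := 𝕜) t m).symm

open Polynomial.Chebyshev in
theorem norm_eval_T_le_one {𝕜 : Type*} [RCLike 𝕜] {t : ℝ} (ht : t ∈ Set.Icc (-1 : ℝ) 1) (m : ℤ) :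
    ‖(T 𝕜 m).eval (t : 𝕜)‖ ≤ 1 := by
  rw [eval_T_ofReal, RCLike.norm_ofReal]
  exact abs_eval_T_real_le_one m (abs_le.2 ht)

/-- The Chebyshev series `∑_{j < N} cⱼ Tⱼ(z)`. -/
def chebSum {𝕜 : Type*} [RCLike 𝕜] (N : ℕ) (c : ℕ → 𝕜) (z : 𝕜) : 𝕜 :=
  ∑ j ∈ Finset.range N, c j * (Polynomial.Chebyshev.T 𝕜 (j : ℤ)).eval z

theorem chebSum_eq_of_le {𝕜 : Type*} [RCLike 𝕜] {N M : ℕ} (h : N ≤ M) {c : ℕ → 𝕜}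
    (hc : ∀ j, N ≤ j → c j = 0) (z : 𝕜) : chebSum N c z = chebSum M c z := by
  refine Finset.sum_subset (Finset.range_mono h) fun j _ hj => ?_
  rw [hc j (by simpa using hj), zero_mul]

section Orthogonality

open Polynomial.Chebyshev Real

theorem integral_T_cos_mul_T_cos (i j : ℕ) :
    ∫ θ in (0 : ℝ)..π, (T ℝ (i : ℤ)).eval (cos θ) * (T ℝ (j : ℤ)).eval (cos θ) =
      if i = j then (if j = 0 then π else π / 2) else 0 := by
  rw [← integral_measureT_eq_integral_cos
    (f := fun x => (T ℝ (i : ℤ)).eval x * (T ℝ (j : ℤ)).eval x)]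
  split_ifs with h h0
  · subst h h0; exact integral_eval_T_real_mul_self_measureT_zero
  · subst h; exact integral_T_real_mul_self_measureT_of_ne_zero h0
  · exact integral_eval_T_real_mul_eval_T_real_measureT_of_ne h

theorem integral_chebSum_mul_T {𝕜 : Type*} [RCLike 𝕜] (N : ℕ) (c : ℕ → 𝕜) {b : ℕ} (hb : b < N) :
    ∫ θ in (0 : ℝ)..π, chebSum N c ((cos θ : ℝ) : 𝕜) *
        (T 𝕜 (b : ℤ)).eval ((cos θ : ℝ) : 𝕜) =
      c b * (((if b = 0 then π else π / 2) : ℝ) : 𝕜) := by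
  have hcont : ∀ j : ℕ, Continuous fun θ : ℝ =>
      c j * (((T ℝ (j : ℤ)).eval (cos θ) * (T ℝ (b : ℤ)).eval (cos θ) : ℝ) : 𝕜) := fun j =>
    continuous_const.mul (RCLike.continuous_ofReal.comp (by fun_prop))
  have h1 : ∀ θ : ℝ, chebSum N c ((cos θ : ℝ) : 𝕜) *
        (T 𝕜 (b : ℤ)).eval ((cos θ : ℝ) : 𝕜) = ∑ j ∈ Finset.range N,
      c j * (((T ℝ (j : ℤ)).eval (cos θ) * (T ℝ (b : ℤ)).eval (cos θ) : ℝ) : 𝕜) := by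
    intro θ
    rw [chebSum, Finset.sum_mul]
    refine Finset.sum_congr rfl fun j _ => ?_
    rw [eval_T_ofReal, eval_T_ofReal]
    push_cast
    ring
  simp_rw [h1]
  rw [intervalIntegral.integral_finsetSum fun j _ => (hcont j).intervalIntegrable _ _]
  simp_rw [intervalIntegral.integral_const_mul, RCLike.intervalIntegral_ofReal,
    integral_T_cos_mul_T_cos]
  rw [Finset.sum_eq_single b]
  · simp
  · intro j _ hj; simp [hj]
  · intro h; exact absurd (Finset.mem_range.2 hb) h

/-- Integrating the series against `T_b` along `t = cos θ` isolates `c b` with weight at least `π /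
2`, while the integral is at most `π M`; hence the factor 2. -/
theorem norm_chebCoeff_le {𝕜 : Type*} [RCLike 𝕜] {N : ℕ} {c : ℕ → 𝕜} {M : ℝ}
    (h : ∀ t ∈ Set.Icc (-1 : ℝ) 1, ‖chebSum N c (t : 𝕜)‖ ≤ M) {b : ℕ} (hb : b < N) :
    ‖c b‖ ≤ 2 * M := by
  have hM : 0 ≤ M := (norm_nonneg _).trans (h 0 (by simp))
  have h1 := intervalIntegral.norm_integral_le_of_norm_le_const (a := 0) (b := π) (C := M)
    (f := fun θ : ℝ => chebSum N c ((cos θ : ℝ) : 𝕜) * (T 𝕜 (b : ℤ)).eval ((cos θ : ℝ) : 𝕜))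
    (fun θ _ => by
      have hc : cos θ ∈ Set.Icc (-1 : ℝ) 1 := ⟨neg_one_le_cos θ, cos_le_one θ⟩
      rw [norm_mul, ← mul_one M]
      exact mul_le_mul (h _ hc) (norm_eval_T_le_one hc _) (norm_nonneg _) hM)
  rw [integral_chebSum_mul_T N c hb, norm_mul, RCLike.norm_ofReal, sub_zero,
    abs_of_pos pi_pos] at h1
  have h2 : π / 2 ≤ |if b = 0 then π else π / 2| := by
    split_ifs
    · rw [abs_of_pos pi_pos]; linarith [pi_pos]
    · exact le_abs_self _
  nlinarith [mul_le_mul_of_nonneg_left h2 (norm_nonneg (c b)), pi_pos]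

end Orthogonality

theorem chebCoeff_eq {𝕜 : Type*} [RCLike 𝕜] {N : ℕ} {c d : ℕ → 𝕜}
    (h : ∀ t ∈ Set.Icc (-1 : ℝ) 1, chebSum N c (t : 𝕜) = chebSum N d (t : 𝕜)) {b : ℕ}
    (hb : b < N) : c b = d b := by
  have := norm_chebCoeff_le (N := N) (c := fun j => c j - d j) (M := 0) (fun t ht => by
    have := h t ht
    simp only [chebSum] at this ⊢
    simp [sub_mul, Finset.sum_sub_distrib, this]) hb
  simpa [sub_eq_zero] using this

/-! ### Multiplication by the variable -/

/-- The Chebyshev coefficients of `z ↦ z ∑ⱼ cⱼ Tⱼ(z)`. -/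
def shift {𝕜 : Type*} [RCLike 𝕜] (c : ℕ → 𝕜) : ℕ → 𝕜
  | 0 => c 1 / 2
  | 1 => c 0 + c 2 / 2
  | b + 2 => (c (b + 1) + c (b + 3)) / 2

open Polynomial.Chebyshev in
theorem eval_T_add_two {𝕜 : Type*} [RCLike 𝕜] (z : 𝕜) (m : ℕ) :
    (T 𝕜 ((m + 2 : ℕ) : ℤ)).eval z =
      2 * z * (T 𝕜 ((m + 1 : ℕ) : ℤ)).eval z - (T 𝕜 (m : ℤ)).eval z := by
  push_cast
  rw [T_add_two]
  simp

open Polynomial.Chebyshev in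
-- The last two coefficients spill past the truncation; keeping these terms explicit lets the
-- three-term recurrence drive the induction.
theorem mul_chebSum_aux {𝕜 : Type*} [RCLike 𝕜] (c : ℕ → 𝕜) (z : 𝕜) (K : ℕ) :
    z * chebSum (K + 3) c z = chebSum (K + 2) (shift c) z +
      (c (K + 2) * (T 𝕜 ((K + 3 : ℕ) : ℤ)).eval z +
        c (K + 1) * (T 𝕜 ((K + 2 : ℕ) : ℤ)).eval z) / 2 := by
  induction K with
  | zero =>
    have h2 := eval_T_add_two z 0
    have h3 := eval_T_add_two z 1
    simp only [chebSum, Finset.sum_range_succ, Finset.sum_range_zero, shift]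
    norm_num at h2 h3 ⊢
    rw [h3, h2]
    ring
  | succ K ih =>
    have h := eval_T_add_two z (K + 2)
    rw [chebSum, Finset.sum_range_succ, ← chebSum, mul_add, ih]
    conv_rhs => rw [chebSum, Finset.sum_range_succ, ← chebSum]
    simp only [shift]
    rw [show K + 1 + 3 = K + 2 + 2 from rfl, h]
    ring

theorem mul_chebSum {𝕜 : Type*} [RCLike 𝕜] {c : ℕ → 𝕜} {k : ℕ} (hc : ∀ j, k ≤ j → c j = 0)
    (z : 𝕜) : z * chebSum k c z = chebSum (k + 2) (shift c) z := by
  rw [chebSum_eq_of_le (by omega : k ≤ k + 3) hc, mul_chebSum_aux, hc (k + 2) (by omega),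
    hc (k + 1) (by omega)]
  simp

theorem shift_eq_zero {𝕜 : Type*} [RCLike 𝕜] {c : ℕ → 𝕜} {k : ℕ} (hc : ∀ j, k ≤ j → c j = 0)
    {b : ℕ} (hb : k + 2 ≤ b) : shift c b = 0 := by
  obtain ⟨b, rfl⟩ : ∃ b', b = b' + 2 := ⟨b - 2, by omega⟩
  simp [shift, hc (b + 1) (by omega), hc (b + 3) (by omega)]

/-- Coefficients of a linear pencil that reproduces a Chebyshev series. -/
theorem shift_add_eq {𝕜 : Type*} [RCLike 𝕜] {k : ℕ} {x y p : ℕ → 𝕜}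
    (hx : ∀ j, k ≤ j → x j = 0) (hy : ∀ j, k ≤ j → y j = 0) (hp : ∀ j, k + 1 ≤ j → p j = 0)
    (h : ∀ t ∈ Set.Icc (-1 : ℝ) 1,
      chebSum k (fun j => (t : 𝕜) * x j + y j) (t : 𝕜) = chebSum (k + 1) p (t : 𝕜)) (b : ℕ) :
    shift x b + y b = p b := by
  rcases lt_or_ge b (k + 2) with hb | hb
  · refine chebCoeff_eq (N := k + 2) (c := fun b => shift x b + y b) (d := p)
      (fun t ht => ?_) hb
    rw [← chebSum_eq_of_le (by omega : k + 1 ≤ k + 2) hp, ← h t ht]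
    have e : chebSum (k + 2) (fun b => shift x b + y b) (t : 𝕜) =
        chebSum (k + 2) (shift x) (t : 𝕜) + chebSum (k + 2) y (t : 𝕜) := by
      simp [chebSum, add_mul, Finset.sum_add_distrib]
    rw [e, ← mul_chebSum hx, ← chebSum_eq_of_le (by omega : k ≤ k + 2) hy]
    simp [chebSum, add_mul, Finset.sum_add_distrib, Finset.mul_sum, mul_assoc]
  · rw [shift_eq_zero hx hb, hy b (by omega), hp b (by omega), add_zero]

/-- Normalisation of the Chebyshev basis: `η 0 = 1` and `η a = 2` otherwise. -/
def eta (𝕜 : Type*) [RCLike 𝕜] (a : ℕ) : 𝕜 := if a = 0 then 1 else 2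

theorem norm_eta_le {𝕜 : Type*} [RCLike 𝕜] (a : ℕ) : ‖eta 𝕜 a‖ ≤ 2 := by
  unfold eta; split_ifs <;> norm_num

/-! ### Hankel structure and coefficient bounds -/

section Recurrence

variable {𝕜 : Type*} [RCLike 𝕜] {k : ℕ} {x y : ℕ → ℕ → 𝕜} {p : ℕ → 𝕜}

/-- The defect `xi a (b + 1) - xi (a + 1) b` is constant along diagonals and vanishes once `k ≤ a`.
-/
theorem hankel_of_shift {xi : ℕ → ℕ → 𝕜}
    (hxi : ∀ a b, k ≤ a → xi a b = 0)
    (h : ∀ a b, xi (a + 1) b + xi (a + 1) (b + 2) = xi a (b + 1) + xi (a + 2) (b + 1))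
    (a b : ℕ) : xi a (b + 1) = xi (a + 1) b := by
  have step : ∀ m a b, k ≤ a + m → xi a (b + 1) = xi (a + 1) b := by
    intro m
    induction m with
    | zero => intro a b hab; rw [hxi _ _ (by omega), hxi _ _ (by omega)]
    | succ m ih =>
      intro a b hab
      have h1 := ih (a + 1) (b + 1) (by omega)
      have h2 := h a b
      rw [h1] at h2
      linear_combination -h2
  exact step k a b (by omega)

theorem norm_le_of_sub_eq {B : ℝ} {h : ℕ → 𝕜} (hh : ∀ b, k ≤ b → h b = 0)
    (hp : ∀ b, ‖p b‖ ≤ B) (hrec : ∀ b, h b - h (b + 2) = p (b + 1)) (b : ℕ) :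
    ‖h b‖ ≤ k * B := by
  have step : ∀ m : ℕ, ∀ b, k ≤ b + m → ‖h b‖ ≤ m * B := by
    intro m
    induction m with
    | zero => intro b hb; rw [hh b (by omega)]; simp
    | succ m ih =>
      intro b hb
      rw [show h b = p (b + 1) + h (b + 2) by linear_combination hrec b]
      refine (norm_add_le _ _).trans ?_
      push_cast
      linarith [hp (b + 1), ih (b + 2) (by omega)]
  exact step k b (by omega)

/-- With weights `eta`, the special cases of `shift` at 0 and 1 become a plain neighbour average,
the index -1 being reflected to 1 as in `T_{-1} = T_1`. -/
theorem shift_eta_mul (g : 𝕜) (xi : ℕ → 𝕜) (b : ℕ) :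
    shift (fun j => g * (eta 𝕜 j * xi j)) b =
      g * (eta 𝕜 b * ((xi (if b = 0 then 1 else b - 1) + xi (b + 1)) / 2)) := by
  rcases b with _ | _ | b <;> simp [shift, eta] <;> ring

/-- Coefficient bounds for a pencil in the double ansatz space with ansatz polynomial `1`. -/
theorem norm_pencilCoeff_le (hx : ∀ a b, k ≤ a ∨ k ≤ b → x a b = 0)
    (h1 : ∀ a b, shift (x a) b + y a b = if a = 0 then p b else 0)
    (h2 : ∀ a b, shift (fun i => x i b) a + y a b = if b = 0 then p a else 0)
    {B : ℝ} (hp : ∀ b, ‖p b‖ ≤ B) (a b : ℕ) :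
    ‖x a b‖ ≤ 4 * (k * B) ∧ ‖y a b‖ ≤ B + 4 * (k * B) := by
  have eta_ne : ∀ a, eta 𝕜 a ≠ 0 := fun a => by unfold eta; split_ifs <;> norm_num
  obtain ⟨xi, rfl⟩ : ∃ xi : ℕ → ℕ → 𝕜, x = fun a b => eta 𝕜 a * (eta 𝕜 b * xi a b) :=
    ⟨fun a b => x a b / (eta 𝕜 a * eta 𝕜 b), by
      ext a b; have := eta_ne a; have := eta_ne b; field_simp⟩
  have hxi : ∀ a b, k ≤ a ∨ k ≤ b → xi a b = 0 := fun a b hab => by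
    simpa [eta_ne] using hx a b hab
  have h2' : ∀ a b, eta 𝕜 b * (eta 𝕜 a * ((xi (if a = 0 then 1 else a - 1) b +
      xi (a + 1) b) / 2)) + y a b = if b = 0 then p a else 0 := fun a b => by
    rw [← h2 a b, ← shift_eta_mul (eta 𝕜 b) (fun i => xi i b) a]
    congr 2
    ext i
    ring
  simp only [shift_eta_mul] at h1
  -- At indices `a + 1`, `b + 1` both right-hand sides vanish, so subtracting cancels `y`.
  have hank : ∀ a b, xi a (b + 1) = xi (a + 1) b := by
    refine hankel_of_shift (k := k) (fun a b ha => hxi a b (Or.inl ha)) fun a b => ?_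
    have e1 := h1 (a + 1) (b + 1)
    have e2 := h2' (a + 1) (b + 1)
    simp [eta] at e1 e2
    linear_combination (e1 - e2) / 2
  -- On row 0 the column identity sees `xi 1 (b + 1)` twice, by reflection; the Hankel property
  -- turns it into `xi 0 (b + 2)`.
  have hrec : ∀ b, xi 0 b - xi 0 (b + 2) = p (b + 1) := fun b => by
    have e1 := h1 0 (b + 1)
    have e2 := h2' 0 (b + 1)
    have e3 := hank 0 (b + 1)
    simp [eta] at e1 e2 e3
    linear_combination e1 - e2 - 2 * e3
  have hxi0 : ∀ a b, xi a b = xi 0 (a + b) := fun a => by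
    induction a with
    | zero => intro b; simp
    | succ a ih =>
      intro b
      rw [← hank, ih]
      congr 1
      omega
  have hbound : ∀ a b, ‖xi a b‖ ≤ k * B := fun a b => by
    rw [hxi0]
    exact norm_le_of_sub_eq (fun b hb => hxi 0 b (Or.inr hb)) hp hrec _
  have hB : 0 ≤ B := (norm_nonneg _).trans (hp 0)
  have hee : ∀ (u : 𝕜), ‖u‖ ≤ k * B → ‖eta 𝕜 a * (eta 𝕜 b * u)‖ ≤ 4 * (k * B) := fun u hu => by
    rw [norm_mul, norm_mul]
    calc ‖eta 𝕜 a‖ * (‖eta 𝕜 b‖ * ‖u‖) ≤ 2 * (2 * (k * B)) := by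
          gcongr <;> exact norm_eta_le _
      _ = 4 * (k * B) := by ring
  refine ⟨hee _ (hbound a b), ?_⟩
  rw [eq_sub_of_add_eq' (h1 a b)]
  refine (norm_sub_le _ _).trans (add_le_add ?_ (hee _ ?_))
  · split_ifs
    · exact hp b
    · simpa using hB
  · rw [norm_div, RCLike.norm_ofNat]
    linarith [norm_add_le (xi a (if b = 0 then 1 else b - 1)) (xi a (b + 1)),
      hbound a (if b = 0 then 1 else b - 1), hbound a (b + 1)]

end Recurrence

/-! ### Entrywise, spectral and supremum norms -/

section Norms

variable {𝕜 : Type*} [RCLike 𝕜] {m : Type*} [Fintype m]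

theorem vecTwoNorm_sq (u : m → 𝕜) : vecTwoNorm u ^ 2 = ∑ i, ‖u i‖ ^ 2 := by
  rw [vecTwoNorm, EuclideanSpace.norm_sq_eq]

theorem vecTwoNorm_nonneg (u : m → 𝕜) : 0 ≤ vecTwoNorm u := norm_nonneg _

variable [DecidableEq m]

theorem norm_entry_le_matTwoNorm (A : Matrix m m 𝕜) (r s : m) : ‖A r s‖ ≤ matTwoNorm A := by
  have h1 := (Matrix.toEuclideanCLM (n := m) (𝕜 := 𝕜) A).le_opNorm (EuclideanSpace.single s 1)
  have h2 := PiLp.norm_apply_le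
    (Matrix.toEuclideanCLM (n := m) (𝕜 := 𝕜) A (EuclideanSpace.single s 1)) r
  have h3 : Matrix.toEuclideanCLM (n := m) (𝕜 := 𝕜) A (EuclideanSpace.single s 1) r = A r s := by
    rw [Matrix.ofLp_toEuclideanCLM]
    simp
  rw [h3] at h2
  simpa [matTwoNorm] using h2.trans h1

/-- Cauchy–Schwarz on each row, then summation over the rows. -/
theorem matTwoNorm_le_card_mul {A : Matrix m m 𝕜} {C : ℝ} (hC : 0 ≤ C)
    (h : ∀ r s, ‖A r s‖ ≤ C) : matTwoNorm A ≤ Fintype.card m * C := by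
  refine ContinuousLinearMap.opNorm_le_bound _ (by positivity) fun u => ?_
  refine abs_le_of_sq_le_sq' ?_ (by positivity) |>.2
  rw [EuclideanSpace.norm_sq_eq, Matrix.ofLp_toEuclideanCLM, mul_pow, EuclideanSpace.norm_sq_eq]
  have hrow : ∀ r, ‖A.mulVec u.ofLp r‖ ^ 2 ≤ C ^ 2 * (Fintype.card m * ∑ s, ‖u s‖ ^ 2) := by
    intro r
    have h1 : ‖A.mulVec u.ofLp r‖ ≤ C * ∑ s, ‖u s‖ := by
      rw [Matrix.mulVec, dotProduct, Finset.mul_sum]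
      refine norm_sum_le_of_le _ fun s _ => ?_
      rw [norm_mul]
      exact mul_le_mul_of_nonneg_right (h r s) (norm_nonneg _)
    calc ‖A.mulVec u.ofLp r‖ ^ 2 ≤ (C * ∑ s, ‖u s‖) ^ 2 := by gcongr
      _ = C ^ 2 * (∑ s, ‖u s‖) ^ 2 := by ring
      _ ≤ C ^ 2 * (Fintype.card m * ∑ s, ‖u s‖ ^ 2) := by
        gcongr
        simpa using sq_sum_le_card_mul_sum_sq (s := Finset.univ) (f := fun s => ‖u s‖)
  calc ∑ r, ‖A.mulVec u.ofLp r‖ ^ 2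
      ≤ ∑ _r : m, C ^ 2 * (Fintype.card m * ∑ s, ‖u s‖ ^ 2) :=
        Finset.sum_le_sum fun r _ => hrow r
    _ = (Fintype.card m * C) ^ 2 * ∑ s, ‖u s‖ ^ 2 := by
        rw [Finset.sum_const, Finset.card_univ, nsmul_eq_mul]
        ring

end Norms

variable {𝕜 : Type*} [RCLike 𝕜] {n k : ℕ}

theorem vecTwoNorm_vecKron_le {w : Fin k → 𝕜} (hw : ∀ i, ‖w i‖ ≤ 1) (u : Fin n → 𝕜) :
    vecTwoNorm (vecKron w u) ≤ √k * vecTwoNorm u := by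
  refine abs_le_of_sq_le_sq' ?_
    (mul_nonneg (Real.sqrt_nonneg _) (vecTwoNorm_nonneg _)) |>.2
  rw [mul_pow, Real.sq_sqrt (Nat.cast_nonneg k), vecTwoNorm_sq, vecTwoNorm_sq,
    Fintype.sum_prod_type]
  calc ∑ i, ∑ a, ‖vecKron w u (i, a)‖ ^ 2 ≤ ∑ _i : Fin k, ∑ a, ‖u a‖ ^ 2 := by
        refine Finset.sum_le_sum fun i _ => Finset.sum_le_sum fun a _ => ?_
        rw [vecKron, norm_mul]
        gcongr
        exact mul_le_of_le_one_left (norm_nonneg _) (hw i)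
    _ = k * ∑ a, ‖u a‖ ^ 2 := by simp

theorem bddAbove_matTwoNorm_matPolyEval (P : Fin (k + 1) → Matrix (Fin n) (Fin n) 𝕜) :
    BddAbove (Set.range fun t : Set.Icc (-1 : ℝ) 1 =>
      matTwoNorm (matPolyEval P ((t : ℝ) : 𝕜))) := by
  refine ⟨∑ j, matTwoNorm (P j), ?_⟩
  rintro _ ⟨t, rfl⟩
  simp only [matTwoNorm, matPolyEval, map_sum, map_smul]
  refine norm_sum_le_of_le _ fun j _ => ?_
  rw [norm_smul]
  exact mul_le_of_le_one_left (norm_nonneg _) (norm_eval_T_le_one t.2 _)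

theorem matTwoNorm_matPolyEval_le_supNorm (P : Fin (k + 1) → Matrix (Fin n) (Fin n) 𝕜) {t : ℝ}
    (ht : t ∈ Set.Icc (-1 : ℝ) 1) :
    matTwoNorm (matPolyEval P (t : 𝕜)) ≤ supNorm (matPolyEval P) :=
  le_ciSup (bddAbove_matTwoNorm_matPolyEval P) ⟨t, ht⟩

theorem supNorm_nonneg {m : Type*} [Fintype m] [DecidableEq m] (A : 𝕜 → Matrix m m 𝕜) :
    0 ≤ supNorm A :=
  Real.iSup_nonneg fun _ => norm_nonneg _

/-! ### From block pencils to scalar coefficients -/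

/-- Chebyshev coefficients of the `(r, s)` entry of a matrix polynomial. -/
def polyCoeff (P : Fin (k + 1) → Matrix (Fin n) (Fin n) 𝕜) (r s : Fin n) (j : ℕ) : 𝕜 :=
  if h : j < k + 1 then P ⟨j, h⟩ r s else 0

theorem matPolyEval_apply (P : Fin (k + 1) → Matrix (Fin n) (Fin n) 𝕜) (z : 𝕜) (r s : Fin n) :
    matPolyEval P z r s = chebSum (k + 1) (polyCoeff P r s) z := by
  rw [matPolyEval, chebSum, Finset.sum_range, Matrix.sum_apply]
  refine Finset.sum_congr rfl fun j _ => ?_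
  rw [polyCoeff, dif_pos j.isLt, Matrix.smul_apply, smul_eq_mul, mul_comm]

theorem norm_polyCoeff_le (P : Fin (k + 1) → Matrix (Fin n) (Fin n) 𝕜) (r s : Fin n) (j : ℕ) :
    ‖polyCoeff P r s j‖ ≤ 2 * supNorm (matPolyEval P) := by
  rcases lt_or_ge j (k + 1) with hj | hj
  · refine norm_chebCoeff_le (N := k + 1) (fun t ht => ?_) hj
    rw [← matPolyEval_apply]
    exact (norm_entry_le_matTwoNorm _ r s).trans (matTwoNorm_matPolyEval_le_supNorm P ht)
  · rw [polyCoeff, dif_neg (by omega), norm_zero]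
    exact mul_nonneg zero_le_two (supNorm_nonneg _)

/-- A family indexed by `Fin k` in descending order, as a sequence in ascending order. -/
def revCoeff (w : Fin k → 𝕜) (a : ℕ) : 𝕜 :=
  if h : a < k then w (Fin.rev ⟨a, h⟩) else 0

theorem revCoeff_rev (w : Fin k → 𝕜) (i : Fin k) : revCoeff w (i.rev : ℕ) = w i := by
  rw [revCoeff, dif_pos i.rev.isLt, Fin.eta, Fin.rev_rev]

theorem revCoeff_eq_zero (w : Fin k → 𝕜) {a : ℕ} (h : k ≤ a) : revCoeff w a = 0 :=
  dif_neg (by omega)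

theorem sum_mul_chebVec (w : Fin k → 𝕜) (z : 𝕜) :
    ∑ i, w i * chebVec k z i = chebSum k (revCoeff w) z := by
  rw [chebSum, Finset.sum_range, ← Equiv.sum_comp Fin.revPerm]
  refine Finset.sum_congr rfl fun j _ => ?_
  simp [revCoeff, chebVec]

theorem revCoeff_of_ansatzEval_eq_one (hk : 1 ≤ k) {w : Fin k → 𝕜}
    (hw : ∀ z : 𝕜, ansatzEval w z = 1) {a : ℕ} (ha : a < k) :
    revCoeff w a = if a = 0 then 1 else 0 := by
  refine chebCoeff_eq (N := k) (d := fun a => if a = 0 then 1 else 0) (fun t _ => ?_) ha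
  rw [← sum_mul_chebVec, ← ansatzEval, hw]
  simp [chebSum, show k ≠ 0 by omega]

theorem mul_colKron_apply (A : Matrix (Fin k × Fin n) (Fin k × Fin n) 𝕜) (c : Fin k → 𝕜)
    (p : Fin k × Fin n) (s : Fin n) :
    (A * colKron c (1 : Matrix (Fin n) (Fin n) 𝕜)) p s = ∑ j, A p (j, s) * c j := by
  simp [Matrix.mul_apply, colKron, Fintype.sum_prod_type, Matrix.one_apply]

theorem rowKron_mul_apply (A : Matrix (Fin k × Fin n) (Fin k × Fin n) 𝕜) (c : Fin k → 𝕜)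
    (q : Fin k × Fin n) (r : Fin n) :
    (rowKron c (1 : Matrix (Fin n) (Fin n) 𝕜) * A) r q = ∑ i, A (i, r) q * c i := by
  simp [Matrix.mul_apply, rowKron, Fintype.sum_prod_type, Matrix.one_apply, mul_comm]

/-- The ansatz vectors of both sides define the same polynomial times `P`. -/
theorem ansatzEval_smul_eq {P : Fin (k + 1) → Matrix (Fin n) (Fin n) 𝕜} {v w : Fin k → 𝕜}
    {X Y : Matrix (Fin k × Fin n) (Fin k × Fin n) 𝕜} (h1 : MemL1 P v X Y) (h2 : MemL2 P w X Y)
    (z : 𝕜) : ansatzEval v z • matPolyEval P z = ansatzEval w z • matPolyEval P z := by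
  have h := Matrix.mul_assoc (rowKron (chebVec k z) (1 : Matrix (Fin n) (Fin n) 𝕜))
    (pencil X Y z) (colKron (chebVec k z) 1)
  rw [h1 z, h2 z] at h
  ext r s
  have h' := congrFun (congrFun h r) s
  simp only [Matrix.mul_apply, rowKron, colKron, Fintype.sum_prod_type, Matrix.of_apply,
    Matrix.one_apply, mul_ite, mul_one, mul_zero, ite_mul, zero_mul, Finset.sum_ite_eq,
    Finset.sum_ite_eq', Finset.mem_univ, if_true] at h'
  simp only [Matrix.smul_apply, smul_eq_mul, ansatzEval, Finset.sum_mul]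
  refine Eq.trans (Finset.sum_congr rfl fun i _ => ?_)
    (h'.symm.trans (Finset.sum_congr rfl fun i _ => ?_)) <;> ring

/-- As polynomials, `(w - 1) q = 0` for a nonzero entry `q` of `P`, and polynomials over a field
have no zero divisors. -/
theorem ansatzEval_eq_one_of_mem {P : Fin (k + 1) → Matrix (Fin n) (Fin n) 𝕜} (hP : P ≠ 0)
    {v w : Fin k → 𝕜} {X Y : Matrix (Fin k × Fin n) (Fin k × Fin n) 𝕜}
    (hv : ∀ z : 𝕜, ansatzEval v z = 1) (h1 : MemL1 P v X Y) (h2 : MemL2 P w X Y) (z : 𝕜) :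
    ansatzEval w z = 1 := by
  let poly (N : ℕ) (c : ℕ → 𝕜) : Polynomial 𝕜 :=
    ∑ j ∈ Finset.range N, Polynomial.C (c j) * Polynomial.Chebyshev.T 𝕜 (j : ℤ)
  have eval_poly : ∀ N c z, (poly N c).eval z = chebSum N c z := fun N c z => by
    simp [poly, chebSum, Polynomial.eval_finsetSum]
  obtain ⟨j, hj⟩ := Function.ne_iff.1 hP
  obtain ⟨r, s, hrs⟩ : ∃ r s, P j r s ≠ 0 := by
    by_contra! h
    exact hj (Matrix.ext h)
  have hq : poly (k + 1) (polyCoeff P r s) ≠ 0 := fun h0 => hrs <| by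
    have := chebCoeff_eq (𝕜 := 𝕜) (N := k + 1) (c := polyCoeff P r s) (d := fun _ => 0)
      (fun t _ => by rw [← eval_poly, h0]; simp [chebSum]) j.isLt
    rwa [polyCoeff, dif_pos j.isLt] at this
  have hw : poly k (revCoeff w) - 1 = 0 := by
    refine (mul_eq_zero.1 (Polynomial.funext fun z => ?_)).resolve_right hq
    have := congrFun (congrFun (ansatzEval_smul_eq h1 h2 z) r) s
    rw [hv, one_smul, Matrix.smul_apply, smul_eq_mul, matPolyEval_apply, ansatzEval,
      sum_mul_chebVec] at this
    simp only [Polynomial.eval_mul, Polynomial.eval_sub, eval_poly, Polynomial.eval_one,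
      Polynomial.eval_zero]
    linear_combination -this
  rw [ansatzEval, sum_mul_chebVec, ← eval_poly, sub_eq_zero.1 hw, Polynomial.eval_one]

theorem norm_pencil_apply_le (hk : 1 ≤ k) {P : Fin (k + 1) → Matrix (Fin n) (Fin n) 𝕜}
    (hP : P ≠ 0) {v : Fin k → 𝕜} (hv : ∀ z : 𝕜, ansatzEval v z = 1)
    {X Y : Matrix (Fin k × Fin n) (Fin k × Fin n) 𝕜} (hL : MemDL P v X Y) {t : ℝ}
    (ht : t ∈ Set.Icc (-1 : ℝ) 1) (p q : Fin k × Fin n) :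
    ‖pencil X Y (t : 𝕜) p q‖ ≤ 18 * k * supNorm (matPolyEval P) := by
  obtain ⟨h1, w, h2⟩ := hL
  have hw := ansatzEval_eq_one_of_mem hP hv h1 h2
  obtain ⟨i, r⟩ := p
  obtain ⟨j, s⟩ := q
  -- Fixing the inner position `(r, s)` leaves a scalar double sequence over the block indices, in
  -- ascending degree and extended by zero.
  let coeff (Z : Matrix (Fin k × Fin n) (Fin k × Fin n) 𝕜) (a b : ℕ) : 𝕜 :=
    revCoeff (fun i => revCoeff (fun j => Z (i, r) (j, s)) b) a
  have coeff_zero : ∀ Z a b, k ≤ a ∨ k ≤ b → coeff Z a b = 0 := by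
    rintro Z a b (h | h)
    · exact revCoeff_eq_zero _ h
    · simp [coeff, revCoeff, show ¬ b < k by omega]
  have poly_zero : ∀ j, k + 1 ≤ j → polyCoeff P r s j = 0 := fun j hj =>
    dif_neg (by omega)
  have ite_zero : ∀ a j, k + 1 ≤ j → (if a = 0 then polyCoeff P r s j else 0) = 0 :=
    fun a j hj => by rw [poly_zero j hj, ite_self]
  have ite_chebSum : ∀ (a : ℕ) (z : 𝕜),
      chebSum (k + 1) (fun j => if a = 0 then polyCoeff P r s j else 0) z =
        (if a = 0 then 1 else 0) * matPolyEval P z r s := fun a z => by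
    rw [matPolyEval_apply]
    split_ifs <;> simp [chebSum]
  have e1 : ∀ a b, shift (coeff X a) b + coeff Y a b =
      if a = 0 then polyCoeff P r s b else 0 := by
    intro a
    rcases lt_or_ge a k with ha | ha
    · refine shift_add_eq (p := fun b => if a = 0 then polyCoeff P r s b else 0)
        (fun j hj => coeff_zero X a j (Or.inr hj)) (fun j hj => coeff_zero Y a j (Or.inr hj))
        (ite_zero a) fun t _ => ?_
      have h := congrFun (congrFun (h1 (t : 𝕜)) (Fin.rev ⟨a, ha⟩, r)) s
      rw [mul_colKron_apply, sum_mul_chebVec] at h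
      rw [ite_chebSum, ← revCoeff_of_ansatzEval_eq_one hk hv ha, revCoeff, dif_pos ha]
      refine Eq.trans ?_ h
      unfold chebSum
      refine Finset.sum_congr rfl fun b hb => ?_
      simp only [coeff, revCoeff, ha, Finset.mem_range.1 hb, pencil, dif_pos, Matrix.add_apply,
        Matrix.smul_apply, smul_eq_mul]
    · intro b
      have : coeff X a = 0 := funext fun b => coeff_zero X a b (Or.inl ha)
      rw [coeff_zero Y a b (Or.inl ha), if_neg (by omega), this]
      rcases b with _ | _ | b <;> simp [shift]
  have e2 : ∀ a b, shift (fun i => coeff X i b) a + coeff Y a b =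
      if b = 0 then polyCoeff P r s a else 0 := by
    intro a b
    revert a
    rcases lt_or_ge b k with hb | hb
    · refine shift_add_eq (y := fun a => coeff Y a b)
        (p := fun a => if b = 0 then polyCoeff P r s a else 0)
        (fun j hj => coeff_zero X j b (Or.inl hj)) (fun j hj => coeff_zero Y j b (Or.inl hj))
        (ite_zero b) fun t _ => ?_
      have h := congrFun (congrFun (h2 (t : 𝕜)) r) (Fin.rev ⟨b, hb⟩, s)
      rw [rowKron_mul_apply, sum_mul_chebVec] at h
      rw [ite_chebSum, ← revCoeff_of_ansatzEval_eq_one hk hw hb, revCoeff, dif_pos hb]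
      refine Eq.trans ?_ h
      unfold chebSum
      refine Finset.sum_congr rfl fun a ha => ?_
      simp only [coeff, revCoeff, hb, Finset.mem_range.1 ha, pencil, dif_pos, Matrix.add_apply,
        Matrix.smul_apply, smul_eq_mul]
    · intro a
      have : (fun i => coeff X i b) = 0 := funext fun a => coeff_zero X a b (Or.inr hb)
      rw [coeff_zero Y a b (Or.inr hb), if_neg (by omega), this]
      rcases a with _ | _ | a <;> simp [shift]
  obtain ⟨hX, hY⟩ := norm_pencilCoeff_le (coeff_zero X) e1 e2 (norm_polyCoeff_le P r s)
    (i.rev : ℕ) (j.rev : ℕ)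
  simp only [coeff, revCoeff_rev] at hX hY
  have ht' : ‖(t : 𝕜)‖ ≤ 1 := by rw [RCLike.norm_ofReal]; exact abs_le.2 ht
  have hk' : (1 : ℝ) ≤ k := by exact_mod_cast hk
  have hS := supNorm_nonneg (matPolyEval P)
  calc ‖pencil X Y (t : 𝕜) (i, r) (j, s)‖ ≤ ‖(t : 𝕜)‖ * ‖X (i, r) (j, s)‖ + ‖Y (i, r) (j, s)‖ := by
        rw [pencil, Matrix.add_apply, Matrix.smul_apply, smul_eq_mul, ← norm_mul]
        exact norm_add_le _ _
    _ ≤ ‖X (i, r) (j, s)‖ + ‖Y (i, r) (j, s)‖ := by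
        gcongr
        exact mul_le_of_le_one_left (norm_nonneg _) ht'
    -- With `B = 2 ‖P(·)‖`, the sum `4 k B + (B + 4 k B)` is at most `9 k B` because `1 ≤ k`.
    _ ≤ 18 * k * supNorm (matPolyEval P) := by nlinarith

theorem supNorm_pencil_le (hk : 1 ≤ k) {P : Fin (k + 1) → Matrix (Fin n) (Fin n) 𝕜}
    (hP : P ≠ 0) {v : Fin k → 𝕜} (hv : ∀ z : 𝕜, ansatzEval v z = 1)
    {X Y : Matrix (Fin k × Fin n) (Fin k × Fin n) 𝕜} (hL : MemDL P v X Y) :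
    supNorm (pencil X Y) ≤ 18 * n * k ^ 2 * supNorm (matPolyEval P) := by
  have : Nonempty (Set.Icc (-1 : ℝ) 1) := ⟨⟨0, by simp⟩⟩
  refine ciSup_le fun t => (matTwoNorm_le_card_mul
    (mul_nonneg (by positivity) (supNorm_nonneg _))
    (norm_pencil_apply_le hk hP hv hL t.2)).trans (le_of_eq ?_)
  simp only [Fintype.card_prod, Fintype.card_fin]
  push_cast
  ring

end ChebDL

end

/-! ### The conditioning bound -/

theorem mainTheorem12 {𝕜 : Type*} [RCLike 𝕜] (n k : ℕ) (hk : 1 ≤ k)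
    (P : Fin (k + 1) → Matrix (Fin n) (Fin n) 𝕜) (hP : P ≠ 0)
    (v : Fin k → 𝕜) (hv : ∀ z : 𝕜, ChebDL.ansatzEval v z = 1)
    (X Y : Matrix (Fin k × Fin n) (Fin k × Fin n) 𝕜) (hL : ChebDL.MemDL P v X Y)
    (lam : ℝ) (hlam : lam ∈ Set.Icc (-1 : ℝ) 1)
    (x y : Fin n → 𝕜) (hx : x ≠ 0) (hy : y ≠ 0)
    (hPx : Matrix.mulVec (ChebDL.matPolyEval P (lam : 𝕜)) x = 0)
    (hyP : Matrix.vecMul y (ChebDL.matPolyEval P (lam : 𝕜)) = 0) :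
    ChebDL.condRatio P v X Y (lam : 𝕜) x y ≤
      16 * (n : ℝ) * (Real.exp 1 - 1) * (k : ℝ) ^ 4 := by
  have he := Real.exp_one_gt_d9
  have hk' : (1 : ℝ) ≤ k := by exact_mod_cast hk
  have hS := ChebDL.supNorm_nonneg (ChebDL.matPolyEval P)
  have hΛ : ∀ i, ‖ChebDL.chebVec k (lam : 𝕜) i‖ ≤ 1 := fun i =>
    ChebDL.norm_eval_T_le_one hlam _
  have hx0 := ChebDL.vecTwoNorm_nonneg x
  have hy0 := ChebDL.vecTwoNorm_nonneg y
  have hfac : (18 : ℝ) * n * k ^ 3 ≤ 16 * n * (Real.exp 1 - 1) * k ^ 4 := by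
    have h1 : (k : ℝ) ^ 3 ≤ k ^ 4 := pow_le_pow_right₀ hk' (by norm_num)
    -- `16 (e - 1)` is about 27.5.
    have h2 : (18 : ℝ) ≤ 16 * (Real.exp 1 - 1) := by linarith
    calc (18 : ℝ) * n * k ^ 3 ≤ 18 * n * k ^ 4 := by gcongr
      _ ≤ (16 * (Real.exp 1 - 1)) * n * k ^ 4 := by gcongr
      _ = 16 * n * (Real.exp 1 - 1) * k ^ 4 := by ring
  rw [ChebDL.condRatio, hv, norm_one, div_one, one_mul]
  refine div_le_of_le_mul₀ (by positivity) (le_trans (by positivity) hfac) ?_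
  calc ChebDL.vecTwoNorm (ChebDL.vecKron (ChebDL.chebVec k (lam : 𝕜)) y) *
        ChebDL.supNorm (ChebDL.pencil X Y) *
        ChebDL.vecTwoNorm (ChebDL.vecKron (ChebDL.chebVec k (lam : 𝕜)) x)
      ≤ (√k * ChebDL.vecTwoNorm y) *
          (18 * n * k ^ 2 * ChebDL.supNorm (ChebDL.matPolyEval P)) *
          (√k * ChebDL.vecTwoNorm x) := by
        gcongr
        · exact ChebDL.vecTwoNorm_nonneg _
        · exact ChebDL.supNorm_nonneg _
        · exact ChebDL.vecTwoNorm_vecKron_le hΛ y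
        · exact ChebDL.supNorm_pencil_le hk hP hv hL
        · exact ChebDL.vecTwoNorm_vecKron_le hΛ x
    _ = (18 * n * k ^ 3) * (ChebDL.vecTwoNorm y * ChebDL.supNorm (ChebDL.matPolyEval P) *
          ChebDL.vecTwoNorm x) := by
        linear_combination (ChebDL.vecTwoNorm y * (18 * n * k ^ 2 *
          ChebDL.supNorm (ChebDL.matPolyEval P)) * ChebDL.vecTwoNorm x) *
          Real.mul_self_sqrt (Nat.cast_nonneg k)
    _ ≤ _ := by gcongr
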